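/- **Setting.** There are $M\ge 1$ clients, $K\ge 2$ arms, and rounds $t=1,2,\dots,T$. An *instance* $\nu$ gives each client $m$ a law of its reward vector $(r^m_1(t),\dots,r^m_K(t))$ with finite means $\mu_i^m$; reward vectors are i.i.d. over time and independent over clients. Put $\mu_i=\frac1M\sum_{m}\mu_i^m$ and $\mu_{i^*}=\max_i\mu_i$. The instance is *homogeneous* if $\mu_i^m$ does not depend on $m$. In each round $t$ every client $m$ pulls an arm $a_m^t$ and observes only its own reward $r^m_{a_m^t}(t)$; then clients that are adjacent in the graph $G_t$ on the $M$ clients exchange all observations they hold. The graph sequence is independent of the rewards. An *algorithm* $\pi$ is any rule, possibly randomized, possibly knowing the horizon $T$, the instances and the graphs, by which each client chooses its arm from the observations (arms pulled and rewards obtained, by itself or others) that have reached it so far. Its expected regret is $$R_T^\pi(\nu)=\mathbb E\Big[T\mu_{i^*}-\frac1M\sum_{t=1}^T\sum_{m=1}^M\mu^m_{a_m^t}\Big],\qquad \bar R_T^\pi(\nu)=\mathbb E\Big[\frac1M\sum_{t=1}^T\sum_{m=1}^M(\mu_{i^*}-\mu_{a_m^t})\Big],$$ where the second version evaluates each pull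 by the global mean of the arm; the two agree on homogeneous instances. **Theorem.** Let $B\subseteq\mathbb R$ and let $\nu$ be any instance with rewards in $B$ almost surely, in which some arm is globally sub-optimal and $\mu_{i^*}<b$ for some $b\in B$ (for example $B=\{0,1\}$ or $B=[0,1]$ and $\mu_{i^*}<1$, or $B=\mathbb R$). Then there are an instance $\nu'$ with rewards in $B$, homogeneous if $\nu$ is, and a constant $c>0$ (neither depending on the graphs, on $T$ or on the algorithm) such that the following holds whenever the graphs $G_t$ are complete, or all connected, or all regular (in each case stationary or varying with time), or Erdős–Rényi random graphs with any edge probability in $[0,1]$, or random connected graphs (of any law). For every $T\ge1$ and every algorithm $\pi$, $$\max\{\bar R_T^\pi(\nu),\bar R_T^\pi(\nu')\}\ \ge\ c\log T,$$ that is, no algorithm has regret $o(\log T)$ on both of the two fixed instances; moreover, if $\bar R_T^\pi(\nu')<c\sqrt T$, then $\bar R_T^\pi(\nu)\ge c\log T$ on the given instance $\nu$ itself. If $\nu$ is homogeneous, the same two statements hold with $R_T^\pi$ in place of $\bar R_T^\pi$. -/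

import Mathlib

open MeasureTheory ProbabilityTheory

namespace MultiAgentBandit

/-- A stochastic environment with `M` clients and `K` arms. `law m` is the law of the reward vector
`(r_1^m(t), …, r_K^m(t))` of client `m` at any one time; the rewards have finite means. -/
structure Env (M K : ℕ) where
  law : Fin M → Measure (Fin K → ℝ)
  isProb : ∀ m, IsProbabilityMeasure (law m)
  integrable : ∀ m i, Integrable (fun x : Fin K → ℝ => x i) (law m)

attribute [instance] Env.isProb

namespace Env

variable {M K : ℕ} (ν : Env M K)

/-- `μ_i^m`, the mean reward of arm `i` at client `m`. -/
noncomputable def clientMean (m : Fin M) (i : Fin K) : ℝ := ∫ x, x i ∂(ν.law m)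

/-- `μ_i`, the expected global reward of arm `i`: the average of `μ_i^m` over the clients. -/
noncomputable def mean (i : Fin K) : ℝ := (1 / (M : ℝ)) * ∑ m, ν.clientMean m i

/-- `μ_{i^*}`, the expected global reward of a globally optimal arm. -/
noncomputable def bestMean : ℝ := ⨆ i, ν.mean i

/-- All clients have the same mean reward on every arm. -/
def Homogeneous : Prop := ∀ m m' i, ν.clientMean m i = ν.clientMean m' i

/-- All rewards lie in `B` almost surely. -/
def RewardsIn (B : Set ℝ) : Prop := ∀ m, ∀ᵐ x ∂(ν.law m), ∀ i, x i ∈ B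

/-- The law of the table `t m i ↦ r_i^m(t)` of all rewards: independent and identically distributed
over time, independent over clients. -/
noncomputable def rewardLaw : Measure (ℕ → Fin M → Fin K → ℝ) :=
  Measure.infinitePi fun _ : ℕ => Measure.pi ν.law

end Env

/-- A graph sequence on the clients; `G t` is the graph at round `t` (rounds are `0, 1, 2, …`). -/
abbrev GraphSeq (M : ℕ) := ℕ → SimpleGraph (Fin M)

/-- What the clients do and see in rounds `0, …, t - 1`: the arm pulled by each client and the reward
that it obtained. -/
abbrev History (M K t : ℕ) := Fin t → Fin M → Fin K × ℝ

/-- `known G t m` is the set of pairs `(s, j)` such that client `m`, when it acts at round `t`, can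
have the arm pulled and the reward obtained by client `j` at round `s`. At the end of round `t` a
client holds its own new observation, those of its neighbours in `G t`, and all that it and these
neighbours held before (information may be relayed). -/
def known {M : ℕ} (G : GraphSeq M) : ℕ → Fin M → Set (ℕ × Fin M)
  | 0, _ => ∅
  | t + 1, m => {p | ∃ j, (j = m ∨ (G t).Adj m j) ∧ (p = (t, j) ∨ p ∈ known G t j)}

/-- An algorithm with bandit feedback, possibly randomized (by a seed, shared or not, drawn from
`seedLaw` independently of everything else). `act t m u G h` is the arm pulled by client `m` at round
`t`; it may only depend on the entries of the history that have reached client `m`, apart from the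
seed and the graphs. -/
structure Policy (M K : ℕ) where
  seedLaw : Measure ℝ
  isProb : IsProbabilityMeasure seedLaw
  act : (t : ℕ) → Fin M → ℝ → GraphSeq M → History M K t → Fin K
  measurable : ∀ t m,
    Measurable fun p : ℝ × GraphSeq M × History M K t => act t m p.1 p.2.1 p.2.2
  local_info : ∀ (t : ℕ) (m : Fin M) (u : ℝ) (G : GraphSeq M) (h h' : History M K t),
    (∀ (s : Fin t) (j : Fin M), ((s : ℕ), j) ∈ known G t m → h s j = h' s j) →
      act t m u G h = act t m u G h'

attribute [instance] Policy.isProb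

namespace Policy

variable {M K : ℕ} (π : Policy M K)

/-- The history that the algorithm produces with seed `u`, graphs `G` and reward table `r`. -/
def history (u : ℝ) (G : GraphSeq M) (r : ℕ → Fin M → Fin K → ℝ) : (t : ℕ) → History M K t
  | 0 => Fin.elim0
  | t + 1 => Fin.snoc (α := fun _ => Fin M → Fin K × ℝ) (history u G r t) fun m =>
      (π.act t m u G (history u G r t), r t m (π.act t m u G (history u G r t)))

/-- `a_m^t`, the arm pulled by client `m` at round `t`. -/
def action (u : ℝ) (G : GraphSeq M) (r : ℕ → Fin M → Fin K → ℝ) (t : ℕ) (m : Fin M) : Fin K :=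
  π.act t m u G (π.history u G r t)

/-- The joint law of seed, graphs and rewards, which are independent. -/
noncomputable def jointLaw (γ : Measure (GraphSeq M)) (ν : Env M K) :
    Measure (ℝ × GraphSeq M × (ℕ → Fin M → Fin K → ℝ)) :=
  π.seedLaw.prod (γ.prod ν.rewardLaw)

/-- The expected regret `E[T μ_{i^*} - (1/M) ∑_t ∑_m μ^m_{a_m^t}]` over `T` rounds, in which a pull of
client `m` counts with the mean reward at client `m` of the arm pulled. -/
noncomputable def regret (γ : Measure (GraphSeq M)) (ν : Env M K) (T : ℕ) : ℝ :=
  ∫ ω, ((T : ℝ) * ν.bestMean - (1 / (M : ℝ)) *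
      ∑ t ∈ Finset.range T, ∑ m, ν.clientMean m (π.action ω.1 ω.2.1 ω.2.2 t m))
    ∂(π.jointLaw γ ν)

/-- The expected regret `E[(1/M) ∑_t ∑_m (μ_{i^*} - μ_{a_m^t})]` over `T` rounds, in which a pull
counts with the expected global reward of the arm pulled. -/
noncomputable def globalRegret (γ : Measure (GraphSeq M)) (ν : Env M K) (T : ℕ) : ℝ :=
  ∫ ω, ((1 / (M : ℝ)) *
      ∑ t ∈ Finset.range T, ∑ m, (ν.bestMean - ν.mean (π.action ω.1 ω.2.1 ω.2.2 t m)))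
    ∂(π.jointLaw γ ν)

end Policy

/-- The graph models, as laws of the graph sequence. In each of them the graphs may be stationary
(all equal) or temporal (varying with time). -/
inductive GraphModel {M : ℕ} : Measure (GraphSeq M) → Prop
  /-- complete graphs -/
  | complete : GraphModel (Measure.dirac fun _ => ⊤)
  /-- a sequence of connected graphs -/
  | connected (G : GraphSeq M) (hG : ∀ t, (G t).Connected) : GraphModel (Measure.dirac G)
  /-- a sequence of regular graphs -/
  | regular (G : GraphSeq M) (hG : ∀ t, ∃ d : ℕ, ∀ v, ((G t).neighborSet v).ncard = d) :
      GraphModel (Measure.dirac G)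
  /-- Erdős–Rényi graphs with edge probability `c`: every `G t` has each edge independently with
  probability `c`; the dependence between different times is arbitrary (independent or not) -/
  | erdosRenyi (c : unitInterval) (γ : Measure (GraphSeq M)) (hγ : IsProbabilityMeasure γ)
      (hc : ∀ t, γ.map (fun G => G t) = SimpleGraph.binomialRandom (Fin M) c) : GraphModel γ
  /-- random graphs that are almost surely connected, with any law -/
  | randomConnected (γ : Measure (GraphSeq M)) (hγ : IsProbabilityMeasure γ)
      (hc : ∀ t, ∀ᵐ G ∂γ, (G t).Connected) : GraphModel γ

end MultiAgentBandit

/-! The lower bound holds even for a central planner that sees all observations at once, so the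
graphs enter only as randomness independent of the rewards. Let `i` be a sub-optimal arm, and let the
second instance replace each reward of arm `i`, independently with probability `p`, by `b`
(`Env.contaminate`). Since `b` exceeds the best mean, arm `i` becomes the unique best arm for `p < 1`
large enough, while the other arms keep their means.

The two instances are coupled: the rewards of the second one are those of the first one, overwritten
where a table of independent coins shows `true` (`map_spikeTable`). A trajectory of the algorithm on
the first instance with `N` pulls of arm `i`, by all clients together, is also its trajectory on the
second one if the coins met at these `N` pulls all show `false`, which has probability `(1 - p) ^ N`
given the trajectory. Hence an event `N ≤ n` that has probability at least `1 / 2` on the first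
instance has probability at least `(1 - p) ^ n / 2` on the second one
(`Policy.pow_mul_measure_pulls_le`).

If the regret on the first instance is below a small multiple of `log T`, then so is the expected
number of pulls of arm `i`. By Markov's inequality the above applies with `n` of order `log T` so
small that `(1 - p) ^ n ≥ 1 / √T`; and on the event `N ≤ n` the second instance incurs regret of
order `T`. Its expected regret is therefore at least of order `√T`
(`Policy.sqrt_le_globalRegret_contaminate`), which dominates `log T`. -/

namespace MultiAgentBandit

open Set

/-! ### Measure-theoretic preliminaries -/

/-- No measurability of `P` is assumed. Inner regularity provides compact sets of almost full
measure on which `P ∘ g` holds, and their images under `g` are compact, hence measurable. -/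
theorem ae_map_of_continuous {X Y : Type*} [TopologicalSpace X] [MeasurableSpace X]
    [OpensMeasurableSpace X] [TopologicalSpace Y] [T2Space Y] [MeasurableSpace Y] [BorelSpace Y]
    {μ : Measure X} [IsFiniteMeasure μ] [μ.InnerRegularCompactLTTop] [T2Space X] {g : X → Y}
    (hg : Continuous g) {P : Y → Prop} (h : ∀ᵐ x ∂μ, P (g x)) : ∀ᵐ y ∂(μ.map g), P y := by
  rw [ae_iff] at h
  set Z := toMeasurable μ {x | ¬ P (g x)} with hZ
  have hZm : MeasurableSet Z := measurableSet_toMeasurable _ _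
  have hZ0 : μ Z = 0 := by rw [hZ, measure_toMeasurable, h]
  rw [ae_iff, ← nonpos_iff_eq_zero]
  refine le_of_forall_pos_le_add fun ε hε => ?_
  obtain ⟨C, hCZ, hC, hCε⟩ :=
    hZm.compl.exists_isCompact_sdiff_lt (μ := μ) (measure_ne_top _ _) hε.ne'
  have hCm : MeasurableSet (g '' C) := (hC.image hg).measurableSet
  calc (μ.map g) {y | ¬ P y} ≤ (μ.map g) (g '' C)ᶜ := by
        refine measure_mono ?_
        rintro y hy ⟨x, hx, rfl⟩
        exact hCZ hx (subset_toMeasurable _ _ hy)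
    _ = μ (g ⁻¹' (g '' C)ᶜ) := Measure.map_apply hg.measurable hCm.compl
    _ ≤ μ (Z ∪ Zᶜ \ C) := by
        refine measure_mono fun x hx => ?_
        by_cases hxZ : x ∈ Z
        · exact Or.inl hxZ
        · exact Or.inr ⟨hxZ, fun hxC => hx (mem_image_of_mem g hxC)⟩
    _ ≤ μ Z + μ (Zᶜ \ C) := measure_union_le _ _
    _ ≤ 0 + ε := by rw [hZ0]; gcongr

/-- Pairing two independent families of independent variables coordinatewise gives an independent
family of pairs. -/
theorem infinitePi_prod_map_zip {ι X Y : Type*} [MeasurableSpace X] [MeasurableSpace Y]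
    (μ : ι → Measure X) (ν : ι → Measure Y) [∀ i, IsProbabilityMeasure (μ i)]
    [∀ i, IsProbabilityMeasure (ν i)] :
    ((Measure.infinitePi μ).prod (Measure.infinitePi ν)).map (fun z i => (z.1 i, z.2 i)) =
      Measure.infinitePi fun i => (μ i).prod (ν i) := by
  refine Measure.eq_infinitePi _ fun s t ht => ?_
  have hmp := measurePreserving_arrowProdEquivProdArrow X Y s (fun i => μ i) (fun i => ν i)
  have hres : ((Measure.infinitePi μ).prod (Measure.infinitePi ν)).map
      (Prod.map (s.restrict (π := fun _ => X)) (s.restrict (π := fun _ => Y))) =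
      (Measure.pi fun i : s => μ i).prod (Measure.pi fun i : s => ν i) := by
    rw [← Measure.map_prod_map _ _ (by fun_prop) (by fun_prop), Measure.infinitePi_map_restrict,
      Measure.infinitePi_map_restrict]
  rw [Measure.map_apply (by fun_prop) (.pi s.countable_toSet fun _ _ => ht _)]
  have hpre : (fun (z : (ι → X) × (ι → Y)) i => (z.1 i, z.2 i)) ⁻¹' ((s : Set ι).pi t) =
      Prod.map (s.restrict (π := fun _ => X)) (s.restrict (π := fun _ => Y)) ⁻¹'
        ((MeasurableEquiv.arrowProdEquivProdArrow X Y s).symm ⁻¹'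
          (univ.pi fun i : s => t i)) := by
    ext z
    simp [Set.mem_pi, MeasurableEquiv.arrowProdEquivProdArrow, Equiv.arrowProdEquivProdArrow]
  have hbox : MeasurableSet (univ.pi fun i : s => t i) := .univ_pi fun i => ht i
  rw [hpre, ← Measure.map_apply (by fun_prop) ((MeasurableEquiv.measurable _) hbox), hres,
    ← hmp.map_eq, MeasurableEquiv.map_apply, ← Set.preimage_comp]
  simp [Measure.pi_pi, Finset.prod_attach s fun i => ((μ i).prod (ν i)) (t i)]

/-! ### The contaminated instance -/

open unitInterval

variable {M K : ℕ}

/-- A biased coin, with `true` of probability `p`. -/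
noncomputable abbrev coin (p : I) : Measure Bool := bernoulliMeasure true false p

/-- The reward vector `z.1`, in which the reward of arm `i` is replaced by `b` if the coin `z.2`
shows `true`. -/
def spike (i : Fin K) (b : ℝ) (z : (Fin K → ℝ) × Bool) : Fin K → ℝ :=
  if z.2 then Function.update z.1 i b else z.1

theorem continuous_spike (i : Fin K) (b : ℝ) : Continuous (spike i b) := by
  refine continuous_prod_of_discrete_right.2 fun c => ?_
  cases c
  · simpa [spike] using continuous_id'
  · simpa [spike] using continuous_id.update i continuous_const

theorem spike_apply_of_ne {i j : Fin K} (h : j ≠ i) (b : ℝ) (z : (Fin K → ℝ) × Bool) :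
    spike i b z j = z.1 j := by
  unfold spike; split_ifs <;> simp [h]

theorem spike_apply_self (i : Fin K) (b : ℝ) (z : (Fin K → ℝ) × Bool) :
    spike i b z i = if z.2 then b else z.1 i := by
  unfold spike; split_ifs <;> simp

theorem integrable_spike (i : Fin K) (b : ℝ) (p : I) {μ : Measure (Fin K → ℝ)}
    [IsProbabilityMeasure μ] (hμ : ∀ j, Integrable (fun x => x j) μ) (j : Fin K) :
    Integrable (fun z => spike i b z j) (μ.prod (coin p)) := by
  have hfst : ∀ j, Integrable (fun z : (Fin K → ℝ) × Bool => z.1 j) (μ.prod (coin p)) :=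
    fun j => (hμ j).comp_fst _
  by_cases h : j = i
  · subst h
    refine Integrable.mono' ((hfst j).norm.add (integrable_const |b|))
      (((continuous_apply j).comp (continuous_spike j b)).measurable.aestronglyMeasurable)
      (ae_of_all _ fun z => ?_)
    rw [spike_apply_self]
    split_ifs <;> simp
  · simpa only [spike_apply_of_ne h] using hfst j

theorem integral_spike (i : Fin K) (b : ℝ) (p : I) {μ : Measure (Fin K → ℝ)}
    [IsProbabilityMeasure μ] (hμ : ∀ j, Integrable (fun x => x j) μ) (j : Fin K) :
    ∫ z, spike i b z j ∂(μ.prod (coin p)) =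
      if j = i then (1 - (p : ℝ)) * ∫ x, x i ∂μ + p * b else ∫ x, x j ∂μ := by
  rw [integral_prod _ (integrable_spike i b p hμ j)]
  split_ifs with h
  · subst h
    simp only [spike_apply_self, coin, integral_bernoulliMeasure]
    simp only [if_true, Bool.false_eq_true, if_false, smul_eq_mul]
    rw [integral_add (integrable_const _) ((hμ j).const_mul _), integral_const, integral_const_mul]
    simp only [probReal_univ, smul_eq_mul, one_mul]
    ring
  · simp [spike_apply_of_ne h]

namespace Env

variable (ν : Env M K)

/-- The instance in which, at every client and every time and with probability `p` independently of
everything else, the reward of arm `i` is replaced by `b`. -/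
noncomputable def contaminate (i : Fin K) (b : ℝ) (p : I) : Env M K where
  law m := ((ν.law m).prod (coin p)).map (spike i b)
  isProb _ := Measure.isProbabilityMeasure_map (continuous_spike i b).measurable.aemeasurable
  integrable m j := (integrable_map_measure
    (measurable_pi_apply j).aestronglyMeasurable (continuous_spike i b).measurable.aemeasurable).2
      (integrable_spike i b p (ν.integrable m) j)

theorem clientMean_contaminate (i : Fin K) (b : ℝ) (p : I) (m : Fin M) (j : Fin K) :
    (ν.contaminate i b p).clientMean m j =
      if j = i then (1 - (p : ℝ)) * ν.clientMean m i + p * b else ν.clientMean m j := by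
  rw [clientMean, contaminate, integral_map (continuous_spike i b).measurable.aemeasurable
    (measurable_pi_apply j).aestronglyMeasurable, integral_spike i b p (ν.integrable m)]
  rfl

theorem mean_contaminate_of_ne {i j : Fin K} (h : j ≠ i) (b : ℝ) (p : I) :
    (ν.contaminate i b p).mean j = ν.mean j := by
  simp [mean, clientMean_contaminate, h]

theorem mean_contaminate_self [NeZero M] (i : Fin K) (b : ℝ) (p : I) :
    (ν.contaminate i b p).mean i = (1 - (p : ℝ)) * ν.mean i + p * b := by
  have hM : (M : ℝ) ≠ 0 := NeZero.ne _
  simp only [mean, clientMean_contaminate, if_true, Finset.sum_add_distrib, ← Finset.mul_sum,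
    Finset.sum_const, Finset.card_univ, Fintype.card_fin, nsmul_eq_mul]
  field_simp

theorem Homogeneous.contaminate {ν : Env M K} (hν : ν.Homogeneous) (i : Fin K) (b : ℝ) (p : I) :
    (ν.contaminate i b p).Homogeneous := fun m m' j => by
  simp only [clientMean_contaminate, hν m m']

theorem RewardsIn.contaminate {ν : Env M K} {B : Set ℝ} (hν : ν.RewardsIn B) (i : Fin K) {b : ℝ}
    (hb : b ∈ B) (p : I) : (ν.contaminate i b p).RewardsIn B := fun m => by
  refine ae_map_of_continuous (continuous_spike i b) (P := fun x => ∀ j, x j ∈ B) ?_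
  filter_upwards [Measure.quasiMeasurePreserving_fst.ae (hν m)] with z hz j
  by_cases h : j = i
  · subst h
    rw [spike_apply_self]
    split_ifs
    exacts [hb, hz j]
  · rw [spike_apply_of_ne h]
    exact hz j

theorem mean_le_bestMean (j : Fin K) : ν.mean j ≤ ν.bestMean :=
  le_ciSup (Set.finite_range _).bddAbove j

end Env

/-- The law of a table of independent coins, one for each time and client. -/
noncomputable def coinTableLaw (M : ℕ) (p : I) : Measure (ℕ → Fin M → Bool) :=
  Measure.infinitePi fun _ => Measure.pi fun _ => coin p

instance (p : I) : IsProbabilityMeasure (coinTableLaw M p) := by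
  unfold coinTableLaw; infer_instance

instance (ν : Env M K) : IsProbabilityMeasure ν.rewardLaw := by
  unfold Env.rewardLaw; infer_instance

/-- The reward table `r`, contaminated where the coin table `c` shows `true`. -/
def spikeTable (i : Fin K) (b : ℝ) (r : ℕ → Fin M → Fin K → ℝ) (c : ℕ → Fin M → Bool) :
    ℕ → Fin M → Fin K → ℝ :=
  fun t m => spike i b (r t m, c t m)

theorem measurable_spikeTable (i : Fin K) (b : ℝ) :
    Measurable fun z : (ℕ → Fin M → Fin K → ℝ) × (ℕ → Fin M → Bool) =>
      spikeTable i b z.1 z.2 := by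
  have := (continuous_spike i b).measurable
  refine measurable_pi_lambda _ fun t => measurable_pi_lambda _ fun m => this.comp ?_
  fun_prop

/-- The rewards of the contaminated instance are obtained from those of the original one and an
independent table of coins. -/
theorem map_spikeTable (ν : Env M K) (i : Fin K) (b : ℝ) (p : I) :
    (ν.rewardLaw.prod (coinTableLaw M p)).map (fun z => spikeTable i b z.1 z.2) =
      (ν.contaminate i b p).rewardLaw := by
  have hspike := (continuous_spike i b).measurable
  have hround : Measure.pi (ν.contaminate i b p).law =
      ((Measure.pi ν.law).prod (Measure.pi fun _ => coin p)).map
        (fun z m => spike i b (z.1 m, z.2 m)) := by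
    have hmp := measurePreserving_arrowProdEquivProdArrow (Fin K → ℝ) Bool (Fin M) ν.law
      (fun _ => coin p)
    rw [← hmp.map_eq, Measure.map_map (by fun_prop) hmp.measurable]
    exact (Measure.pi_map_pi fun m => hspike.aemeasurable).symm
  have hrow : Measurable fun z : (Fin M → Fin K → ℝ) × (Fin M → Bool) =>
      fun m => spike i b (z.1 m, z.2 m) := by fun_prop
  rw [Env.rewardLaw, Env.rewardLaw, hround, ← Measure.infinitePi_map_pi _ fun _ => hrow,
    ← infinitePi_prod_map_zip, Measure.map_map (by fun_prop) (by fun_prop)]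
  rfl

/-- The probability that the coins show `false` at all entries `(t, m)`, `t < T`, at which the
table `a` shows `i`. -/
theorem coinTableLaw_forall_eq_false (p : I) (T : ℕ) (a : ℕ → Fin M → Fin K) (i : Fin K) :
    coinTableLaw M p {c | ∀ t < T, ∀ m, a t m = i → c t m = false} =
      ENNReal.ofReal (1 - p) ^ ∑ t ∈ Finset.range T, Finset.card {m | a t m = i} := by
  have hset : {c : ℕ → Fin M → Bool | ∀ t < T, ∀ m, a t m = i → c t m = false} =
      (Finset.range T : Set ℕ).pi fun t =>
        univ.pi fun m => if a t m = i then {false} else univ := by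
    ext c
    simp only [Set.mem_ofPred_eq, Set.mem_pi, Finset.coe_range, Set.mem_Iio, Set.mem_univ,
      forall_true_left]
    refine forall₃_congr fun t _ m => ?_
    split_ifs with h <;> simp [h]
  have hfalse : coin p {false} = ENNReal.ofReal (1 - p) := by
    rw [coin, bernoulliMeasure_apply_of_notMem_of_mem p (.singleton _) (by simp) (by simp)]
    rw [ENNReal.ofReal]
    congr 1
    ext
    simp [sub_nonneg.2 p.2.2]
  rw [hset, coinTableLaw, Measure.infinitePi_pi _ fun t _ => .univ_pi fun m => .of_discrete,
    ← Finset.prod_pow_eq_pow_sum]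
  refine Finset.prod_congr rfl fun t _ => ?_
  rw [Measure.pi_pi]
  simp only [apply_ite (coin p), measure_univ, hfalse, Finset.prod_ite, Finset.prod_const,
    one_pow, mul_one]

/-! ### Trajectories of an algorithm -/

namespace Policy

variable (π : Policy M K)

/-- An algorithm only sees the rewards of the arms pulled: changing the others has no effect. -/
theorem history_congr {u : ℝ} {G : GraphSeq M} {r r' : ℕ → Fin M → Fin K → ℝ} {T : ℕ}
    (h : ∀ t < T, ∀ m, r' t m (π.action u G r t m) = r t m (π.action u G r t m)) :
    ∀ t ≤ T, π.history u G r' t = π.history u G r t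
  | 0, _ => rfl
  | t + 1, ht => by
    have ih := history_congr h t (Nat.le_of_succ_le ht)
    have hr := h t ht
    unfold action at hr
    simp only [history, ih, hr]

theorem action_congr {u : ℝ} {G : GraphSeq M} {r r' : ℕ → Fin M → Fin K → ℝ} {T : ℕ}
    (h : ∀ t < T, ∀ m, r' t m (π.action u G r t m) = r t m (π.action u G r t m))
    {t : ℕ} (ht : t < T) (m : Fin M) : π.action u G r' t m = π.action u G r t m := by
  unfold action
  rw [π.history_congr h t ht.le]

theorem measurable_action_of_history (t : ℕ)
    (h : Measurable fun ω : ℝ × GraphSeq M × (ℕ → Fin M → Fin K → ℝ) =>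
      π.history ω.1 ω.2.1 ω.2.2 t) (m : Fin M) :
    Measurable fun ω : ℝ × GraphSeq M × (ℕ → Fin M → Fin K → ℝ) =>
      π.action ω.1 ω.2.1 ω.2.2 t m :=
  (π.measurable t m).comp (measurable_fst.prodMk ((measurable_fst.comp measurable_snd).prodMk h))

theorem measurable_history : ∀ t : ℕ,
    Measurable fun ω : ℝ × GraphSeq M × (ℕ → Fin M → Fin K → ℝ) => π.history ω.1 ω.2.1 ω.2.2 t
  | 0 => measurable_const
  | t + 1 => by
    have ih := measurable_history t
    have heval : Measurable fun q : Fin K × (Fin K → ℝ) => q.2 q.1 :=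
      measurable_from_prod_countable_right fun j => measurable_pi_apply j
    refine measurable_pi_lambda _ fun s => ?_
    induction s using Fin.lastCases with
    | last =>
      simp only [history, Fin.snoc_last]
      refine measurable_pi_lambda _ fun m => ?_
      have ha := π.measurable_action_of_history t ih m
      refine ha.prodMk (heval.comp (ha.prodMk ?_))
      fun_prop
    | cast s =>
      simp only [history, Fin.snoc_castSucc]
      exact (measurable_pi_apply s).comp ih

@[fun_prop]
theorem measurable_action (t : ℕ) (m : Fin M) :
    Measurable fun ω : ℝ × GraphSeq M × (ℕ → Fin M → Fin K → ℝ) =>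
      π.action ω.1 ω.2.1 ω.2.2 t m :=
  π.measurable_action_of_history t (π.measurable_history t) m

/-- The number of pulls of arm `i`, by all clients together, in the first `T` rounds. -/
def pulls (i : Fin K) (T : ℕ) (ω : ℝ × GraphSeq M × (ℕ → Fin M → Fin K → ℝ)) : ℕ :=
  ∑ t ∈ Finset.range T, Finset.card {m | π.action ω.1 ω.2.1 ω.2.2 t m = i}

theorem pulls_eq_sum_ite (i : Fin K) (T : ℕ) (ω : ℝ × GraphSeq M × (ℕ → Fin M → Fin K → ℝ)) :
    π.pulls i T ω =
      ∑ t ∈ Finset.range T, ∑ m, if π.action ω.1 ω.2.1 ω.2.2 t m = i then 1 else 0 := by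
  simp only [pulls, Finset.card_filter]

theorem measurable_pulls (i : Fin K) (T : ℕ) : Measurable (π.pulls i T) := by
  have : π.pulls i T = fun ω => ∑ t ∈ Finset.range T, ∑ m,
      (fun j : Fin K => if j = i then 1 else 0) (π.action ω.1 ω.2.1 ω.2.2 t m) :=
    funext fun ω => π.pulls_eq_sum_ite i T ω
  rw [this]
  exact Finset.measurable_fun_sum _ fun t _ => Finset.measurable_fun_sum _ fun m _ =>
    (measurable_of_countable fun j : Fin K => if j = i then 1 else 0).comp
      (π.measurable_action t m)

theorem pulls_le (i : Fin K) (T : ℕ) (ω : ℝ × GraphSeq M × (ℕ → Fin M → Fin K → ℝ)) :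
    π.pulls i T ω ≤ T * M := by
  refine (Finset.sum_le_card_nsmul _ _ M fun t _ => ?_).trans (by simp)
  exact (Finset.card_le_univ _).trans (by simp)

theorem regret_eq_globalRegret [NeZero M] (γ : Measure (GraphSeq M)) {ν : Env M K}
    (hν : ν.Homogeneous) (T : ℕ) :
    π.regret γ ν T = π.globalRegret γ ν T := by
  have hM : (M : ℝ) ≠ 0 := NeZero.ne _
  have hmean : ∀ m i, ν.clientMean m i = ν.mean i := fun m i => by
    simp only [Env.mean, hν _ m]
    simp [hM]
  unfold regret globalRegret
  congr 1
  funext ω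
  simp only [hmean, Finset.sum_sub_distrib]
  simp
  field_simp

/-! ### Change of measure -/

variable (γ : Measure (GraphSeq M)) (ν : Env M K) [IsProbabilityMeasure γ]

instance : IsProbabilityMeasure (π.jointLaw γ ν) := by
  unfold jointLaw; infer_instance

theorem measurePreserving_spikeTable (i : Fin K) (b : ℝ) (p : I) :
    MeasurePreserving (fun z : (ℝ × GraphSeq M × (ℕ → Fin M → Fin K → ℝ)) × (ℕ → Fin M → Bool) =>
        (z.1.1, z.1.2.1, spikeTable i b z.1.2.2 z.2))
      ((π.jointLaw γ ν).prod (coinTableLaw M p)) (π.jointLaw γ (ν.contaminate i b p)) := by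
  have hspike : MeasurePreserving (fun z : (ℕ → Fin M → Fin K → ℝ) × (ℕ → Fin M → Bool) =>
      spikeTable i b z.1 z.2) (ν.rewardLaw.prod (coinTableLaw M p))
      (ν.contaminate i b p).rewardLaw := ⟨measurable_spikeTable i b, map_spikeTable ν i b p⟩
  exact ((MeasurePreserving.id _).prod ((MeasurePreserving.id _).prod hspike)).comp
    (((MeasurePreserving.id π.seedLaw).prod
      (measurePreserving_prodAssoc γ ν.rewardLaw (coinTableLaw M p))).comp
        (measurePreserving_prodAssoc π.seedLaw (γ.prod ν.rewardLaw) (coinTableLaw M p)))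

/-- As long as the coins show `false` whenever arm `i` is pulled, which has conditional probability
`(1 - p) ^ N` for a trajectory with `N` pulls of arm `i`, the trajectories on the original and on
the contaminated rewards coincide. -/
theorem pow_mul_measure_pulls_le (i : Fin K) (b : ℝ) (p : I) (T n : ℕ) :
    ENNReal.ofReal (1 - p) ^ n * π.jointLaw γ ν {ω | π.pulls i T ω ≤ n} ≤
      π.jointLaw γ (ν.contaminate i b p) {ω | π.pulls i T ω ≤ n} := by
  have hA : MeasurableSet {ω | π.pulls i T ω ≤ n} := π.measurable_pulls i T measurableSet_Iic
  have hmp := π.measurePreserving_spikeTable γ ν i b p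
  rw [← hmp.measure_preimage hA.nullMeasurableSet, Measure.prod_apply (hmp.measurable hA),
    ← setLIntegral_const]
  refine (setLIntegral_mono' hA fun ω hω => ?_).trans (setLIntegral_le_lintegral _ _)
  calc ENNReal.ofReal (1 - p) ^ n ≤ ENNReal.ofReal (1 - p) ^ π.pulls i T ω :=
        pow_le_pow_right_of_le_one' (ENNReal.ofReal_le_one.2 (by linarith [p.2.1])) hω
    _ = coinTableLaw M p {c | ∀ t < T, ∀ m,
          π.action ω.1 ω.2.1 ω.2.2 t m = i → c t m = false} :=
        (coinTableLaw_forall_eq_false p T _ i).symm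
    _ ≤ _ := by
        refine measure_mono fun c hc => ?_
        have hagree : ∀ t < T, ∀ m,
            spikeTable i b ω.2.2 c t m (π.action ω.1 ω.2.1 ω.2.2 t m) =
              ω.2.2 t m (π.action ω.1 ω.2.1 ω.2.2 t m) := by
          intro t ht m
          by_cases h : π.action ω.1 ω.2.1 ω.2.2 t m = i
          · simp [spikeTable, spike, hc t ht m h]
          · exact spike_apply_of_ne h b _
        have hpulls : π.pulls i T (ω.1, ω.2.1, spikeTable i b ω.2.2 c) = π.pulls i T ω := by
          refine Finset.sum_congr rfl fun t ht => ?_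
          simp only [π.action_congr hagree (Finset.mem_range.1 ht)]
        exact hpulls.le.trans hω

/-! ### Regret and numbers of pulls -/

theorem integrable_sum_gap (T : ℕ) :
    Integrable (fun ω => (1 / (M : ℝ)) * ∑ t ∈ Finset.range T, ∑ m,
      (ν.bestMean - ν.mean (π.action ω.1 ω.2.1 ω.2.2 t m))) (π.jointLaw γ ν) := by
  refine Integrable.const_mul (integrable_finsetSum _ fun t _ => integrable_finsetSum _ fun m _ =>
    ?_) _
  have hfin : Finite (Fin K) := inferInstance
  obtain ⟨C, hC⟩ := (Set.finite_range fun j => ‖ν.bestMean - ν.mean j‖).bddAbove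
  exact Integrable.of_bound ((measurable_of_countable fun j : Fin K =>
    ν.bestMean - ν.mean j).comp (π.measurable_action t m)).aestronglyMeasurable C
    (ae_of_all _ fun ω => hC ⟨_, rfl⟩)

theorem gap_mul_integral_pulls_le (i : Fin K) (T : ℕ) :
    (ν.bestMean - ν.mean i) / M * ∫ ω, (π.pulls i T ω : ℝ) ∂(π.jointLaw γ ν) ≤
      π.globalRegret γ ν T := by
  rw [← integral_const_mul]
  refine integral_mono_of_nonneg (ae_of_all _ fun ω => ?_) (π.integrable_sum_gap γ ν T)
    (ae_of_all _ fun ω => ?_)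
  · have := ν.mean_le_bestMean i
    have : 0 ≤ ν.bestMean - ν.mean i := by linarith
    simp only [Pi.zero_apply]
    positivity
  · have hsum : (ν.bestMean - ν.mean i) * π.pulls i T ω ≤ ∑ t ∈ Finset.range T, ∑ m,
        (ν.bestMean - ν.mean (π.action ω.1 ω.2.1 ω.2.2 t m)) := by
      simp only [pulls_eq_sum_ite, Nat.cast_sum, Finset.mul_sum]
      refine Finset.sum_le_sum fun t _ => Finset.sum_le_sum fun m _ => ?_
      split_ifs with h
      · simp [h]
      · simpa using ν.mean_le_bestMean _
    calc (ν.bestMean - ν.mean i) / M * π.pulls i T ω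
        = 1 / (M : ℝ) * ((ν.bestMean - ν.mean i) * π.pulls i T ω) := by ring
      _ ≤ _ := mul_le_mul_of_nonneg_left hsum (by positivity)

/-- On the event that arm `i` is pulled at most `n` times, the other arms together are pulled
at least `T * M - n` times. -/
theorem gap_mul_measure_pulls_le {i : Fin K} {δ : ℝ} (hδ : 0 ≤ δ)
    (hgap : ∀ j ≠ i, δ ≤ ν.bestMean - ν.mean j) (T n : ℕ) :
    δ / M * (T * M - n) * (π.jointLaw γ ν).real {ω | π.pulls i T ω ≤ n} ≤
      π.globalRegret γ ν T := by
  have hA : MeasurableSet {ω | π.pulls i T ω ≤ n} := π.measurable_pulls i T measurableSet_Iic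
  have hgap0 : ∀ j, 0 ≤ ν.bestMean - ν.mean j := fun j => sub_nonneg.2 (ν.mean_le_bestMean j)
  rw [mul_comm, ← smul_eq_mul, ← integral_indicator_const _ hA]
  refine integral_mono (integrable_const _ |>.indicator hA) (π.integrable_sum_gap γ ν T)
    fun ω => indicator_apply_le' (fun hω => ?_) fun _ => ?_
  · have hlow : δ * (T * M - π.pulls i T ω) ≤ ∑ t ∈ Finset.range T, ∑ m,
        (ν.bestMean - ν.mean (π.action ω.1 ω.2.1 ω.2.2 t m)) := by
      have : (T * M - π.pulls i T ω : ℝ) = ∑ t ∈ Finset.range T, ∑ m,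
          (1 - if π.action ω.1 ω.2.1 ω.2.2 t m = i then 1 else 0 : ℝ) := by
        simp [pulls_eq_sum_ite, Finset.sum_sub_distrib]
      simp only [this, Finset.mul_sum]
      refine Finset.sum_le_sum fun t _ => Finset.sum_le_sum fun m _ => ?_
      split_ifs with h
      · simpa using ν.mean_le_bestMean _
      · simpa using hgap _ h
    have hn : (π.pulls i T ω : ℝ) ≤ n := by exact_mod_cast hω
    calc δ / M * (T * M - n) = 1 / (M : ℝ) * (δ * (T * M - n)) := by ring
      _ ≤ 1 / (M : ℝ) * (δ * (T * M - π.pulls i T ω)) := by gcongr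
      _ ≤ _ := by gcongr
  · exact mul_nonneg (by positivity)
      (Finset.sum_nonneg fun t _ => Finset.sum_nonneg fun m _ => hgap0 _)

end Policy

/-! ### The trade-off between the two instances -/

theorem GraphModel.isProbabilityMeasure {γ : Measure (GraphSeq M)} (h : GraphModel γ) :
    IsProbabilityMeasure γ := by
  cases h <;> first | assumption | infer_instance

theorem log_le_two_mul_sqrt {x : ℝ} (hx : 0 ≤ x) : Real.log x ≤ 2 * √x := by
  have h := Real.log_le_rpow_div hx (show (0 : ℝ) < 1 / 2 by norm_num)
  rw [← Real.sqrt_eq_rpow] at h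
  linarith

/-- Markov's inequality for a variable with values in `ℕ`. -/
theorem measure_le_ge_half {Ω : Type*} [MeasurableSpace Ω] {P : Measure Ω} [IsProbabilityMeasure P]
    {N : Ω → ℕ} (hN : Measurable N) (hint : Integrable (fun ω => (N ω : ℝ)) P) {y : ℝ} (hy : 0 < y)
    (h : ∫ ω, (N ω : ℝ) ∂P ≤ y) : 1 / 2 ≤ P.real {ω | N ω ≤ ⌊2 * y⌋₊} := by
  have hA : MeasurableSet {ω | N ω ≤ ⌊2 * y⌋₊} := hN measurableSet_Iic
  have hmarkov := mul_meas_ge_le_integral_of_nonneg (ae_of_all P fun ω => Nat.cast_nonneg (N ω))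
    hint (2 * y)
  have hcompl : P.real {ω | N ω ≤ ⌊2 * y⌋₊}ᶜ ≤ P.real {ω | 2 * y ≤ (N ω : ℝ)} := by
    refine measureReal_mono fun ω hω => ?_
    exact (Nat.lt_of_floor_lt (not_le.1 hω)).le
  rw [probReal_compl_eq_one_sub hA] at hcompl
  have : P.real {ω | 2 * y ≤ (N ω : ℝ)} ≤ 1 / 2 := by
    by_contra! hlt
    nlinarith
  linarith

/-- The fraction of `log T` up to which the expected number of pulls of the contaminated arm leaves
the two instances hard to tell apart. It is at most `1 / 4`, and chosen such that
`(1 - p) ^ (2 * pullRate p * log T) ≥ T ^ (-1 / 2)`. -/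
noncomputable def pullRate (p : I) : ℝ := 1 / (4 * (1 - Real.log (1 - p)))

theorem log_one_sub_nonpos (p : I) : Real.log (1 - p) ≤ 0 :=
  Real.log_nonpos (sub_nonneg.2 p.2.2) (by linarith [p.2.1])

theorem pullRate_pos (p : I) : 0 < pullRate p := by
  have := log_one_sub_nonpos p
  unfold pullRate
  apply one_div_pos.2
  linarith

theorem pullRate_le (p : I) : pullRate p ≤ 1 / 4 := by
  have := log_one_sub_nonpos p
  unfold pullRate
  exact one_div_le_one_div_of_le (by norm_num) (by linarith)

theorem pullRate_mul_log (p : I) : -(1 / 4) ≤ pullRate p * Real.log (1 - p) := by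
  have := log_one_sub_nonpos p
  have h : pullRate p * (1 - Real.log (1 - p)) = 1 / 4 := by
    unfold pullRate
    have : 1 - Real.log (1 - p) ≠ 0 := by linarith
    field_simp
  have := pullRate_pos p
  nlinarith

theorem one_div_sqrt_le_pow {p : I} (hp : (p : ℝ) < 1) {T : ℕ} (hT : 1 ≤ T) :
    1 / √(T : ℝ) ≤ (1 - (p : ℝ)) ^ ⌊2 * (pullRate p * Real.log T)⌋₊ := by
  have hT' : (1 : ℝ) ≤ T := by exact_mod_cast hT
  have hlogT := Real.log_nonneg hT'
  have hrate := pullRate_pos p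
  have hfloor : (⌊2 * (pullRate p * Real.log T)⌋₊ : ℝ) ≤ 2 * (pullRate p * Real.log T) :=
    Nat.floor_le (by positivity)
  have hsqrt : 0 < √(T : ℝ) := Real.sqrt_pos.2 (by linarith)
  rw [one_div, ← Real.log_le_log_iff (inv_pos.2 hsqrt) (pow_pos (sub_pos.2 hp) _), Real.log_inv,
    Real.log_sqrt (by linarith), Real.log_pow]
  have h1 := mul_le_mul_of_nonpos_right hfloor (log_one_sub_nonpos p)
  have h2 := mul_le_mul_of_nonneg_right (pullRate_mul_log p) hlogT
  linarith

/-- Small regret on the original instance forces the sub-optimal arm `i` to be pulled so rarely that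
the algorithm cannot detect its contamination. -/
theorem Policy.sqrt_le_globalRegret_contaminate [NeZero M] (π : Policy M K)
    (γ : Measure (GraphSeq M)) [IsProbabilityMeasure γ] (ν : Env M K) {i : Fin K}
    (hi : ν.mean i < ν.bestMean) {b : ℝ} {p : I} (hp : (p : ℝ) < 1)
    (hbest : ν.bestMean < (ν.contaminate i b p).mean i) {T : ℕ} (hT : 1 ≤ T)
    (hreg : π.globalRegret γ ν T < (ν.bestMean - ν.mean i) / M * pullRate p * Real.log T) :
    ((ν.contaminate i b p).mean i - ν.bestMean) / 4 * √(T : ℝ) ≤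
      π.globalRegret γ (ν.contaminate i b p) T := by
  set ν' := ν.contaminate i b p with hν'
  have hM : (1 : ℝ) ≤ M := by exact_mod_cast NeZero.one_le
  have hT' : (1 : ℝ) ≤ T := by exact_mod_cast hT
  set y := pullRate p * Real.log T with hy
  set n := ⌊2 * y⌋₊ with hn
  have hΔ : 0 < (ν.bestMean - ν.mean i) / M := div_pos (sub_pos.2 hi) (by linarith)
  have hmean : ∫ ω, (π.pulls i T ω : ℝ) ∂(π.jointLaw γ ν) < y := by
    refine lt_of_mul_lt_mul_left ?_ hΔ.le
    rw [hy, ← mul_assoc]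
    exact (π.gap_mul_integral_pulls_le γ ν i T).trans_lt hreg
  have hypos : 0 < y := lt_of_le_of_lt (integral_nonneg fun ω => Nat.cast_nonneg _) hmean
  have hint : Integrable (fun ω => (π.pulls i T ω : ℝ)) (π.jointLaw γ ν) :=
    Integrable.of_bound (measurable_from_top.comp (π.measurable_pulls i T)).aestronglyMeasurable
      (T * M) (ae_of_all _ fun ω => by simpa using mod_cast π.pulls_le i T ω)
  have hhalf := measure_le_ge_half (π.measurable_pulls i T) hint hypos hmean.le
  have hchange : (1 - (p : ℝ)) ^ n * (π.jointLaw γ ν).real {ω | π.pulls i T ω ≤ n} ≤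
      (π.jointLaw γ ν').real {ω | π.pulls i T ω ≤ n} := by
    have h := ENNReal.toReal_mono (measure_ne_top _ _) (π.pow_mul_measure_pulls_le γ ν i b p T n)
    rwa [ENNReal.toReal_mul, ENNReal.toReal_pow, ENNReal.toReal_ofReal (sub_nonneg.2 hp.le)] at h
  have hprob : 1 / √(T : ℝ) * (1 / 2) ≤ (π.jointLaw γ ν').real {ω | π.pulls i T ω ≤ n} :=
    (mul_le_mul (one_div_sqrt_le_pow hp hT) hhalf (by norm_num)
      (pow_nonneg (sub_nonneg.2 hp.le) _)).trans hchange
  have hgap : ∀ j ≠ i, ν'.mean i - ν.bestMean ≤ ν'.bestMean - ν'.mean j := fun j hj => by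
    rw [hν', ν.mean_contaminate_of_ne hj]
    linarith [ν'.mean_le_bestMean i, ν.mean_le_bestMean j]
  have hδ : 0 < ν'.mean i - ν.bestMean := sub_pos.2 hbest
  refine le_trans ?_ (π.gap_mul_measure_pulls_le γ ν' hδ.le hgap T n)
  have hfew : T * M / 2 ≤ (T * M - n : ℝ) := by
    have h1 : (n : ℝ) ≤ 2 * y := Nat.floor_le (by positivity)
    have h2 : Real.log T ≤ T := (Real.log_le_sub_one_of_pos (by linarith)).trans (by linarith)
    have h3 : y ≤ 1 / 4 * T :=
      mul_le_mul (pullRate_le p) h2 (Real.log_nonneg hT') (by norm_num)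
    nlinarith
  have hsq : (T : ℝ) = √T * √T := (Real.mul_self_sqrt (by linarith)).symm
  have hsqrt : 0 < √(T : ℝ) := Real.sqrt_pos.2 (by linarith)
  calc (ν'.mean i - ν.bestMean) / 4 * √(T : ℝ)
      = (ν'.mean i - ν.bestMean) / M * (√T * √T * M / 2) * (1 / √(T : ℝ) * (1 / 2)) := by
        field_simp; norm_num
    _ = (ν'.mean i - ν.bestMean) / M * (T * M / 2) * (1 / √(T : ℝ) * (1 / 2)) := by rw [← hsq]
    _ ≤ _ := mul_le_mul (mul_le_mul_of_nonneg_left hfew (div_nonneg hδ.le (by linarith))) hprob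
        (by positivity)
        (mul_nonneg (div_nonneg hδ.le (by linarith)) (le_trans (by positivity) hfew))

end MultiAgentBandit

theorem theorem3 (M K : ℕ) (B : Set ℝ) (ν : MultiAgentBandit.Env M K) (hν : ν.RewardsIn B)
    (hgap : ∃ i, ν.mean i < ν.bestMean) (hB : ∃ b ∈ B, ν.bestMean < b) :
    ∃ ν' : MultiAgentBandit.Env M K,
      ν'.RewardsIn B ∧ (ν.Homogeneous → ν'.Homogeneous) ∧
      ∃ c : ℝ, 0 < c ∧
        ∀ γ : Measure (MultiAgentBandit.GraphSeq M), MultiAgentBandit.GraphModel γ →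
        ∀ T : ℕ, 1 ≤ T → ∀ π : MultiAgentBandit.Policy M K,
          (c * Real.log T ≤ max (π.globalRegret γ ν T) (π.globalRegret γ ν' T) ∧
            (π.globalRegret γ ν' T < c * √(T : ℝ) → c * Real.log T ≤ π.globalRegret γ ν T)) ∧
          (ν.Homogeneous →
            c * Real.log T ≤ max (π.regret γ ν T) (π.regret γ ν' T) ∧
            (π.regret γ ν' T < c * √(T : ℝ) → c * Real.log T ≤ π.regret γ ν T)) := by
  obtain ⟨i, hi⟩ := hgap
  obtain ⟨b, hbB, hb⟩ := hB
  have hMne : NeZero M := ⟨by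
    -- Without clients all means are `0`, so that no arm is sub-optimal.
    rintro rfl
    have : Nonempty (Fin K) := ⟨i⟩
    simp [MultiAgentBandit.Env.mean, MultiAgentBandit.Env.bestMean] at hi⟩
  have hib : 0 < b - ν.mean i := by linarith
  -- Contamination with a probability above this ratio makes `i` the best arm.
  obtain ⟨q, hq, hq1⟩ := exists_between
    (show (ν.bestMean - ν.mean i) / (b - ν.mean i) < 1 from (div_lt_one hib).2 (by linarith))
  have hq0 : 0 ≤ q := (div_nonneg (by linarith) hib.le).trans hq.le
  set p : unitInterval := ⟨q, hq0, hq1.le⟩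
  have hp : (p : ℝ) < 1 := hq1
  have hbest : ν.bestMean < (ν.contaminate i b p).mean i := by
    rw [ν.mean_contaminate_self]
    have := (div_lt_iff₀ hib).1 hq
    change _ < (1 - q) * ν.mean i + q * b
    linarith
  set ν' := ν.contaminate i b p with hν'
  have hM : (0 : ℝ) < M := by exact_mod_cast NeZero.pos M
  set c := min ((ν.bestMean - ν.mean i) / M * MultiAgentBandit.pullRate p)
    ((ν'.mean i - ν.bestMean) / 8) with hc
  have hc0 : 0 < c := lt_min
    (mul_pos (div_pos (sub_pos.2 hi) hM) (MultiAgentBandit.pullRate_pos p))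
    (div_pos (sub_pos.2 hbest) (by norm_num))
  have hmain : ∀ γ : Measure (MultiAgentBandit.GraphSeq M), MultiAgentBandit.GraphModel γ →
      ∀ T : ℕ, 1 ≤ T → ∀ π : MultiAgentBandit.Policy M K,
        c * Real.log T ≤ max (π.globalRegret γ ν T) (π.globalRegret γ ν' T) ∧
          (π.globalRegret γ ν' T < c * √(T : ℝ) → c * Real.log T ≤ π.globalRegret γ ν T) := by
    intro γ hγ T hT π
    have := hγ.isProbabilityMeasure
    have hlog : 0 ≤ Real.log T := Real.log_nonneg (by exact_mod_cast hT)
    rcases le_or_gt (c * Real.log T) (π.globalRegret γ ν T) with h | h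
    · exact ⟨h.trans (le_max_left _ _), fun _ => h⟩
    have hlarge : 2 * c * √(T : ℝ) ≤ π.globalRegret γ ν' T := by
      refine le_trans ?_ (π.sqrt_le_globalRegret_contaminate γ ν hi hp hbest hT
        (h.trans_le (mul_le_mul_of_nonneg_right (min_le_left _ _) hlog)))
      refine mul_le_mul_of_nonneg_right ?_ (Real.sqrt_nonneg _)
      have : c ≤ (ν'.mean i - ν.bestMean) / 8 := min_le_right _ _
      linarith
    refine ⟨le_max_of_le_right (le_trans ?_ hlarge), fun hlt => ?_⟩
    · have := mul_le_mul_of_nonneg_left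
        (MultiAgentBandit.log_le_two_mul_sqrt (Nat.cast_nonneg T)) hc0.le
      linarith
    · have := mul_nonneg hc0.le (Real.sqrt_nonneg (T : ℝ))
      linarith
  refine ⟨ν', hν.contaminate i hbB p, fun h => h.contaminate i b p, c, hc0,
    fun γ hγ T hT π => ⟨hmain γ hγ T hT π, fun hhom => ?_⟩⟩
  rw [π.regret_eq_globalRegret γ hhom, π.regret_eq_globalRegret γ (hhom.contaminate i b p)]
  exact hmain γ hγ T hT π
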